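/- Let $n\ge 0$, let $U\subseteq\mathbb{R}^{n+1}$ be open and let $v=(v^0,\dots,v^n)$ be a $C^1$ vector field on $U$ with local flow $\varphi_t$ in $U$; thus $\varphi_t(x)$ (for $t$ of either sign) is defined exactly when the solution of $\dot x^i=v^i(x)$ starting at $x$ exists inside $U$ up to time $t$. For a function $\Delta$ on $U$ let $\Delta_t$ be its transport by the flow: $\Delta_t(\varphi_t(x))=\Delta(x)$, and $\Delta_t=0$ outside the range of $\varphi_t$. For $\rho\in C^1(U)$ (of any sign), the measure $d\mu=\rho\,dx^0\wedge\dots\wedge dx^n$ on $U$ is said to be preserved by the flow of $v$ if $\int_U\Delta_t\,d\mu=\int_U\Delta\,d\mu$ for every $C^\infty$ function $\Delta$ with compact support in $U$ and every $t$ such that $\varphi_t$ is defined on the support of $\Delta$. (1) For every $\rho\in C^1(U)$, the measure $\rho\,dx^0\wedge\dots\wedge dx^n$ is preserved by the flow of $v$ if and only if $$v\cdot\nabla\rho+\rho\,\nabla\cdot v=0\quad\text{on }U.$$ (2) Let $\rho_A,\rho_B\in C^1(U)$ be two solutions of this equation on $U$, and let $W\subseteq U$ be an open set on which $\rho_B$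 has no zero and on which $\rho_A,\rho_B$ are linearly independent over $\mathbb{R}$. Then $\rho_A/\rho_B$ is an integral of the flow on $W$: it is a nonconstant $C^1$ function on $W$, it satisfies $v\cdot\nabla(\rho_A/\rho_B)=0$ on $W$, and it is constant along the trajectories of $v$ in $W$. -/

import Mathlib

open MeasureTheory
open scoped ContDiff Gradient

noncomputable section

/-- The Euclidean space `ℝⁿ⁺¹` with coordinates `x⁰, …, xⁿ`. -/
abbrev Space (n : ℕ) : Type := EuclideanSpace ℝ (Fin (n + 1))

/-- The operator `D_t = v · ∇ = ∑ i, vⁱ ∂ᵢ` applied to a function `f`. -/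
def flowDeriv {n : ℕ} (v : Space n → Space n) (f : Space n → ℝ) (x : Space n) : ℝ :=
  inner ℝ (v x) (∇ f x)

/-- The divergence `∇ · v = ∑ i, ∂ᵢ vⁱ`. -/
def divergence {n : ℕ} (v : Space n → Space n) (x : Space n) : ℝ :=
  ∑ i, fderiv ℝ (fun y => v y i) x (EuclideanSpace.single i 1)

/-- `ρ` solves `v · ∇ρ + ρ ∇ · v = 0` on `U`. -/
def SolvesDensityEq {n : ℕ} (v : Space n → Space n) (U : Set (Space n))
    (ρ : Space n → ℝ) : Prop :=
  ∀ x ∈ U, flowDeriv v ρ x + ρ x * divergence v x = 0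

/-- `y = φ_t(x)`, for the (local) flow `φ` of `v` in `U`: the solution of `γ' = v(γ)` that starts
at `x` at time `0` exists, inside `U`, up to the (positive or negative) time `t`, at which it is
at `y`. -/
def FlowsTo {n : ℕ} (v : Space n → Space n) (U : Set (Space n)) (t : ℝ) (x y : Space n) : Prop :=
  ∃ γ : ℝ → Space n, γ 0 = x ∧ γ t = y ∧ (∀ s ∈ Set.uIcc 0 t, γ s ∈ U) ∧
    IsIntegralCurveOn γ (fun _ => v) (Set.uIcc 0 t)

/-- The domain of `φ_t`: the points whose trajectory exists in `U` up to time `t`. -/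
def flowDomain {n : ℕ} (v : Space n → Space n) (U : Set (Space n)) (t : ℝ) : Set (Space n) :=
  {x | ∃ y, FlowsTo v U t x y}

open Classical in
/-- The function `Δ_t` obtained by transporting `Δ` with the flow for the time `t`:
`Δ_t(φ_t(x)) = Δ(x)`, and `Δ_t = 0` outside the range of `φ_t`. (When `v` is `C¹` on the open
set `U`, the point `x` with `φ_t(x) = y` is unique if it exists.) -/
def transport {n : ℕ} (v : Space n → Space n) (U : Set (Space n)) (t : ℝ)
    (Δ : Space n → ℝ) (y : Space n) : ℝ :=
  if h : ∃ x, FlowsTo v U t x y then Δ h.choose else 0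

/-- The measure `dμ = ρ dx⁰ ∧ … ∧ dxⁿ` on `U` is preserved by the flow of `v` in `U`:
`μ(Δ_t) = μ(Δ)` for every smooth function `Δ` with compact support in `U` and every time `t` up to
which the flow is defined on the support of `Δ`. Both integrands are continuous with compact
support in `U` when `v` is `C¹` and `ρ` is continuous on the open set `U`. -/
def PreservedByFlow {n : ℕ} (v : Space n → Space n) (U : Set (Space n))
    (ρ : Space n → ℝ) : Prop :=
  ∀ Δ : Space n → ℝ, ContDiff ℝ ∞ Δ → HasCompactSupport Δ → tsupport Δ ⊆ U →
    ∀ t : ℝ, tsupport Δ ⊆ flowDomain v U t →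
      ∫ x in U, transport v U t Δ x * ρ x = ∫ x in U, Δ x * ρ x

/-- `f` is an integral on `W` of the flow `ẋ = v(x)`: a nonconstant `C¹` function with
`D_t f = 0`, which is constant along the trajectories of `v` in `W`. -/
structure IsLocalIntegral {n : ℕ} (v : Space n → Space n) (W : Set (Space n))
    (f : Space n → ℝ) : Prop where
  contDiffOn : ContDiffOn ℝ 1 f W
  flowDeriv_eq_zero : ∀ x ∈ W, flowDeriv v f x = 0
  const_along_flow : ∀ (t : ℝ) (x y : Space n), FlowsTo v W t x y → f y = f x
  nonconstant : ∃ x ∈ W, ∃ y ∈ W, f x ≠ f y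

end

/-!
The transported function is `Δ_t = Δ ∘ φ_{-t}`, and the classical proof differentiates
`μ(Δ_t) = ∫ Δ(x) ρ(φ_t(x)) J_t(x) dx`, which needs the Jacobian `J_t` of the flow. Here the change of
variables is avoided. Since `Δ_t` is Lipschitz by Grönwall's inequality, it is differentiable almost
everywhere by Rademacher's theorem, and differentiating under the integral sign gives
`d/dt ∫ Δ_t ρ = - ∫ (v · ∇Δ_t) ρ = ∫ Δ_t ∇ · (ρ v)`, the second equality being integration by parts
for Lipschitz functions (`IsGlobalFlow.hasDerivAt_integral`, `integral_neg_fderiv_mul_eq`). As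
`∇ · (ρ v) = v · ∇ρ + ρ ∇ · v`, a solution of the density equation has constant `μ(Δ_t)`
(`SolvesDensityEq.preservedByFlow`). Conversely, if `μ` is preserved, the derivative at `t = 0` shows
that `∇ · (ρ v)` is orthogonal to all test functions, hence zero
(`PreservedByFlow.integral_mul_eq_zero`, `PreservedByFlow.solvesDensityEq`).

The flow of `v` in `U` is only local. All trajectories that start in the support of `Δ` and last for
the time `t` stay in a compact subset of `U` (`exists_isCompact_trajectories_subset`), so `v` and `ρ`
may be replaced by compactly supported `C¹` extensions from a neighbourhood of that set, and the
local flow by the global flow of the extended field (`IsGlobalFlow.transport_eq`).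

For two solutions, the quotient rule cancels the divergence terms and gives
`v · ∇(ρ_A / ρ_B) = 0`; a constant quotient would be a linear relation
(`SolvesDensityEq.isLocalIntegral_div`).
-/

/-! ### Global flows of bounded Lipschitz vector fields -/

section GlobalFlow

variable {E : Type*} [NormedAddCommGroup E] [NormedSpace ℝ E]

/-- `Φ` is the global flow of the autonomous vector field `w`: the curve `s ↦ Φ s x` is defined for
all times, solves `γ' = w γ`, and starts at `x`. -/
structure IsGlobalFlow (w : E → E) (Φ : ℝ → E → E) : Prop where
  zero : ∀ x, Φ 0 x = x
  hasDerivAt : ∀ x s, HasDerivAt (fun s => Φ s x) (w (Φ s x)) s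

/-- Since the Picard–Lindelöf theorem applies on every time interval `[-T, T]`, the solutions on
`[-(k + 1), k + 1]`, `k ∈ ℕ`, glue to a global one. -/
theorem exists_isGlobalFlow [CompleteSpace E] {w : E → E} {K : NNReal} (hw : LipschitzWith K w)
    {M : ℝ} (hM : ∀ x, ‖w x‖ ≤ M) : ∃ Φ : ℝ → E → E, IsGlobalFlow w Φ := by
  have hM0 : 0 ≤ M := (norm_nonneg _).trans (hM 0)
  have key : ∀ (x : E) (k : ℕ), ∃ α : ℝ → E, α 0 = x ∧
      ∀ t ∈ Set.Icc (-(k + 1 : ℝ)) (k + 1),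
        HasDerivWithinAt α (w (α t)) (Set.Icc (-(k + 1 : ℝ)) (k + 1)) t := by
    intro x k
    have h0 : (0 : ℝ) ∈ Set.Icc (-(k + 1 : ℝ)) (k + 1) := by
      constructor <;> linarith [(Nat.cast_nonneg k : (0 : ℝ) ≤ k)]
    have hpl : IsPicardLindelof (fun _ => w) (⟨0, h0⟩ : Set.Icc (-(k + 1 : ℝ)) (k + 1)) x
        (M.toNNReal * (k + 1)) 0 M.toNNReal K :=
      IsPicardLindelof.of_time_independent
        (fun y _ => (hM y).trans (Real.le_coe_toNNReal M)) hw.lipschitzOnWith (by simp)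
    exact hpl.exists_eq_forall_mem_Icc_hasDerivWithinAt₀
  choose α hα0 hα using key
  have hderiv : ∀ (x : E) (k : ℕ) (t : ℝ), t ∈ Set.Ioo (-(k + 1 : ℝ)) (k + 1) →
      HasDerivAt (α x k) (w (α x k t)) t := fun x k t ht =>
    (hα x k t (Set.Ioo_subset_Icc_self ht)).hasDerivAt (Icc_mem_nhds ht.1 ht.2)
  have hagree : ∀ x (k l : ℕ), k ≤ l →
      Set.EqOn (α x k) (α x l) (Set.Ioo (-(k + 1 : ℝ)) (k + 1)) := by
    intro x k l hkl
    have hkl' : (k : ℝ) ≤ l := by exact_mod_cast hkl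
    have hk : (0 : ℝ) ≤ k := Nat.cast_nonneg k
    refine ODE_solution_unique_of_mem_Ioo (v := fun _ => w) (s := fun _ => Set.univ) (K := K)
      (t₀ := 0) (fun _ _ => hw.lipschitzOnWith) ⟨by linarith, by linarith⟩
      (fun t ht => ⟨hderiv x k t ht, trivial⟩)
      (fun t ht => ⟨hderiv x l t ⟨by linarith [ht.1], by linarith [ht.2]⟩, trivial⟩) ?_
    rw [hα0, hα0]
  refine ⟨fun t x => α x ⌈|t|⌉₊ t, ⟨fun x => hα0 x _, fun x t => ?_⟩⟩
  have hN : ∀ᶠ s in nhds t, (fun s => α x ⌈|s|⌉₊ s) s = α x (⌈|t|⌉₊ + 1) s := by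
    have : ∀ᶠ s in nhds t, |s| < |t| + 1 :=
      continuous_abs.continuousAt.eventually_lt continuousAt_const (by linarith)
    filter_upwards [this] with s hs
    refine hagree x _ _ ?_ (abs_lt.1 ?_)
    · rw [← Nat.ceil_add_one (abs_nonneg t)]
      exact Nat.ceil_mono hs.le
    · exact (Nat.le_ceil _).trans_lt (lt_add_one _)
  have ht : HasDerivAt (α x (⌈|t|⌉₊ + 1)) (w (α x (⌈|t|⌉₊ + 1) t)) t := by
    refine hderiv x _ t (abs_lt.1 ?_)
    push_cast
    linarith [Nat.le_ceil |t|]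
  rw [show α x ⌈|t|⌉₊ t = _ from hN.self_of_nhds]
  exact ht.congr_of_eventuallyEq hN

theorem IsIntegralCurveOn.hasDerivWithinAt_Ici {w : E → E} {γ : ℝ → E} {a b s : ℝ}
    (hγ : IsIntegralCurveOn γ (fun _ => w) (Set.Icc a b)) (hs : s ∈ Set.Ico a b) :
    HasDerivWithinAt γ (w (γ s)) (Set.Ici s) s :=
  (hγ s (Set.Ico_subset_Icc_self hs)).mono_of_mem_nhdsWithin
    (Filter.mem_of_superset (Icc_mem_nhdsGE hs.2) (Set.Icc_subset_Icc_left hs.1))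

theorem IsIntegralCurveOn.hasDerivWithinAt_Iic {w : E → E} {γ : ℝ → E} {a b s : ℝ}
    (hγ : IsIntegralCurveOn γ (fun _ => w) (Set.Icc a b)) (hs : s ∈ Set.Ioc a b) :
    HasDerivWithinAt γ (w (γ s)) (Set.Iic s) s :=
  (hγ s (Set.Ioc_subset_Icc_self hs)).mono_of_mem_nhdsWithin
    (Filter.mem_of_superset (Icc_mem_nhdsLE hs.1) (Set.Icc_subset_Icc_right hs.2))

namespace IsGlobalFlow

variable {w : E → E} {Φ : ℝ → E → E} {K : NNReal}

theorem isIntegralCurveOn (hΦ : IsGlobalFlow w Φ) (x : E) (S : Set ℝ) :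
    IsIntegralCurveOn (fun s => Φ s x) (fun _ => w) S :=
  fun s _ => (hΦ.hasDerivAt x s).hasDerivWithinAt

theorem eq_of_isIntegralCurveOn (hΦ : IsGlobalFlow w Φ) (hw : LipschitzWith K w) {γ : ℝ → E}
    {t : ℝ} (hγ : IsIntegralCurveOn γ (fun _ => w) (Set.uIcc 0 t)) :
    ∀ s ∈ Set.uIcc 0 t, γ s = Φ s (γ 0) := by
  rcases le_total 0 t with ht | ht
  · rw [Set.uIcc_of_le ht] at hγ ⊢
    have hΦ' := hΦ.isIntegralCurveOn (γ 0) (Set.Icc 0 t)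
    exact ODE_solution_unique_of_mem_Icc_right (v := fun _ => w) (s := fun _ => Set.univ)
      (fun _ _ => hw.lipschitzOnWith) hγ.continuousOn (fun s hs => hγ.hasDerivWithinAt_Ici hs)
      (fun _ _ => trivial) hΦ'.continuousOn (fun s hs => hΦ'.hasDerivWithinAt_Ici hs)
      (fun _ _ => trivial) (hΦ.zero _).symm
  · rw [Set.uIcc_of_ge ht] at hγ ⊢
    have hΦ' := hΦ.isIntegralCurveOn (γ 0) (Set.Icc t 0)
    exact ODE_solution_unique_of_mem_Icc_left (v := fun _ => w) (s := fun _ => Set.univ)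
      (fun _ _ => hw.lipschitzOnWith) hγ.continuousOn (fun s hs => hγ.hasDerivWithinAt_Iic hs)
      (fun _ _ => trivial) hΦ'.continuousOn (fun s hs => hΦ'.hasDerivWithinAt_Iic hs)
      (fun _ _ => trivial) (hΦ.zero _).symm

theorem add (hΦ : IsGlobalFlow w Φ) (hw : LipschitzWith K w) (s t : ℝ) (x : E) :
    Φ (t + s) x = Φ t (Φ s x) := by
  have h : IsIntegralCurveOn (fun r => Φ (r + s) x) (fun _ => w) (Set.uIcc 0 t) :=
    fun r _ => ((hΦ.hasDerivAt x (r + s)).comp_add_const r s).hasDerivWithinAt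
  simpa using hΦ.eq_of_isIntegralCurveOn hw h t Set.right_mem_uIcc

theorem neg_apply (hΦ : IsGlobalFlow w Φ) (hw : LipschitzWith K w) (t : ℝ) (x : E) :
    Φ (-t) (Φ t x) = x := by
  rw [← hΦ.add hw, neg_add_cancel, hΦ.zero]

theorem apply_neg (hΦ : IsGlobalFlow w Φ) (hw : LipschitzWith K w) (t : ℝ) (x : E) :
    Φ t (Φ (-t) x) = x := by
  rw [← hΦ.add hw, add_neg_cancel, hΦ.zero]

theorem reverse (hΦ : IsGlobalFlow w Φ) : IsGlobalFlow (-w) (fun s => Φ (-s)) where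
  zero x := by simpa using hΦ.zero x
  hasDerivAt x s := by
    simpa [Function.comp_def] using (hΦ.hasDerivAt x (-s)).scomp s (hasDerivAt_neg s)

theorem dist_le (hΦ : IsGlobalFlow w Φ) (hw : LipschitzWith K w) (s : ℝ) (x y : E) :
    dist (Φ s x) (Φ s y) ≤ dist x y * Real.exp (K * |s|) := by
  -- negative times reduce to positive ones for the field `-w`
  have forward : ∀ {w : E → E} {Φ : ℝ → E → E}, IsGlobalFlow w Φ → LipschitzWith K w →
      ∀ s, 0 ≤ s → dist (Φ s x) (Φ s y) ≤ dist x y * Real.exp (K * s) := by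
    intro w Φ hΦ hw s hs
    have h := fun x => hΦ.isIntegralCurveOn x (Set.Icc 0 s)
    simpa using dist_le_of_trajectories_ODE (v := fun _ => w) (fun _ => hw) (h x).continuousOn
      (fun r hr => (h x).hasDerivWithinAt_Ici hr) (h y).continuousOn
      (fun r hr => (h y).hasDerivWithinAt_Ici hr)
      (by simp only [hΦ.zero]; exact le_rfl) s ⟨hs, le_rfl⟩
  rcases le_total 0 s with hs | hs
  · rw [abs_of_nonneg hs]
    exact forward hΦ hw s hs
  · rw [abs_of_nonpos hs]
    simpa using forward hΦ.reverse hw.neg (-s) (by linarith)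

theorem lipschitzWith (hΦ : IsGlobalFlow w Φ) (hw : LipschitzWith K w) (s : ℝ) :
    LipschitzWith (Real.exp (K * |s|)).toNNReal (Φ s) :=
  LipschitzWith.of_dist_le_mul fun x y => by
    rw [Real.coe_toNNReal _ (Real.exp_pos _).le, mul_comm]
    exact hΦ.dist_le hw s x y

theorem lipschitzWith_time (hΦ : IsGlobalFlow w Φ) {M : NNReal} (hM : ∀ x, ‖w x‖ ≤ M) (x : E) :
    LipschitzWith M (fun s => Φ s x) :=
  lipschitzWith_of_nnnorm_deriv_le (fun s => (hΦ.hasDerivAt x s).differentiableAt) fun s => by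
    rw [(hΦ.hasDerivAt x s).deriv]
    exact hM _

end IsGlobalFlow

end GlobalFlow

/-! ### Cutoffs -/

/-- A `C¹` map on an open set `U` agrees, near any given compact subset of `U`, with a compactly
supported `C¹` map on the whole space. -/
theorem ContDiffOn.exists_hasCompactSupport_eqOn {E F : Type*} [NormedAddCommGroup E]
    [NormedSpace ℝ E] [FiniteDimensional ℝ E] [NormedAddCommGroup F] [NormedSpace ℝ F]
    {U K : Set E} {f : E → F} (hf : ContDiffOn ℝ 1 f U) (hU : IsOpen U) (hK : IsCompact K)
    (hKU : K ⊆ U) :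
    ∃ g : E → F, ContDiff ℝ 1 g ∧ HasCompactSupport g ∧ ∀ x ∈ K, g =ᶠ[nhds x] f := by
  obtain ⟨L, hL, hKL, hLU⟩ := exists_compact_between hK hU hKU
  obtain ⟨L', hL', hLL', hL'U⟩ := exists_compact_between hL hU hLU
  obtain ⟨χ, hχ, -, hsupp, hone⟩ := exists_contMDiff_support_eq_eq_one_iff (n := 1)
    (modelWithCornersSelf ℝ E) isOpen_interior hL.isClosed hLL'
  have htsupp : tsupport χ ⊆ L' := by
    rw [tsupport, hsupp]
    exact closure_minimal interior_subset hL'.isClosed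
  have htsupp' : tsupport (fun x => χ x • f x) ⊆ L' :=
    (closure_mono (Function.support_smul_subset_left χ f)).trans htsupp
  refine ⟨fun x => χ x • f x, ?_, HasCompactSupport.of_support_subset_isCompact hL'
    ((subset_tsupport _).trans htsupp'), fun x hx => ?_⟩
  · rw [contDiff_iff_contDiffAt]
    intro x
    by_cases hx : x ∈ U
    · exact hχ.contDiff.contDiffAt.smul (hf.contDiffAt (hU.mem_nhds hx))
    · have hx' : x ∉ tsupport (fun x => χ x • f x) := fun h => hx (hL'U (htsupp' h))
      exact (contDiffAt_const (c := (0 : F))).congr_of_eventuallyEq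
        (notMem_tsupport_iff_eventuallyEq.1 hx')
  · filter_upwards [mem_interior_iff_mem_nhds.1 (hKL hx)] with y hy
    simp [(hone y).1 hy]

/-! ### The divergence of `ρ v` -/

section Divergence

variable {n : ℕ}

theorem eq_sum_smul_single (z : Space n) :
    z = ∑ i, z i • EuclideanSpace.single i (1 : ℝ) := by
  ext j
  simp [Finset.sum_apply, Pi.single_apply]

theorem flowDeriv_eq_fderiv (v : Space n → Space n) (f : Space n → ℝ) (x : Space n) :
    flowDeriv v f x = fderiv ℝ f x (v x) := by
  rw [flowDeriv, real_inner_comm, inner_gradient_left]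

/-- The left-hand side of the density equation is the divergence of the field `ρ v`. -/
theorem flowDeriv_add_mul_divergence {v : Space n → Space n} {ρ : Space n → ℝ} {x : Space n}
    (hρ : DifferentiableAt ℝ ρ x) (hv : DifferentiableAt ℝ v x) :
    flowDeriv v ρ x + ρ x * divergence v x =
      ∑ i, fderiv ℝ (fun y => ρ y * v y i) x (EuclideanSpace.single i 1) := by
  have hvi : ∀ i, DifferentiableAt ℝ (fun y => v y i) x := fun i =>
    (differentiableAt_euclidean.1 hv) i
  rw [flowDeriv_eq_fderiv, divergence]
  conv_lhs => enter [1]; rw [eq_sum_smul_single (v x)]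
  rw [map_sum, Finset.mul_sum, ← Finset.sum_add_distrib]
  refine Finset.sum_congr rfl fun i _ => ?_
  rw [fderiv_fun_mul hρ (hvi i)]
  simp
  ring

theorem flowDeriv_add_mul_divergence_congr {v w : Space n → Space n} {ρ σ : Space n → ℝ}
    {x : Space n} (hv : w =ᶠ[nhds x] v) (hρ : σ =ᶠ[nhds x] ρ) :
    flowDeriv w σ x + σ x * divergence w x = flowDeriv v ρ x + ρ x * divergence v x := by
  rw [flowDeriv_eq_fderiv, flowDeriv_eq_fderiv, hρ.fderiv_eq, hv.self_of_nhds, hρ.self_of_nhds,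
    divergence, divergence]
  congr 2
  refine Finset.sum_congr rfl fun i _ => ?_
  have hi : (fun y => w y i) =ᶠ[nhds x] fun y => v y i := hv.fun_comp fun z => z i
  rw [hi.fderiv_eq]

theorem continuousOn_flowDeriv_add_mul_divergence {v : Space n → Space n} {ρ : Space n → ℝ}
    {U : Set (Space n)} (hU : IsOpen U) (hv : ContDiffOn ℝ 1 v U) (hρ : ContDiffOn ℝ 1 ρ U) :
    ContinuousOn (fun x => flowDeriv v ρ x + ρ x * divergence v x) U := by
  have hvi : ∀ i, ContDiffOn ℝ 1 (fun y => v y i) U := fun i => (contDiffOn_euclidean.1 hv) i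
  refine ContinuousOn.add ?_ (hρ.continuousOn.mul (continuousOn_finsetSum _ fun i _ => ?_))
  · rw [show flowDeriv v ρ = fun x => fderiv ℝ ρ x (v x) from funext (flowDeriv_eq_fderiv v ρ)]
    exact (hρ.continuousOn_fderiv_of_isOpen hU le_rfl).clm_apply hv.continuousOn
  · exact ((hvi i).continuousOn_fderiv_of_isOpen hU le_rfl).clm_apply continuousOn_const

/-- Integration by parts against the field `σ w`. By Rademacher's theorem the left-hand side makes
sense for a function `g` that is merely Lipschitz. -/
theorem integral_neg_fderiv_mul_eq {w : Space n → Space n} {σ g : Space n → ℝ}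
    (hw : ContDiff ℝ 1 w) (hσ : ContDiff ℝ 1 σ) (hσs : HasCompactSupport σ) {C : NNReal}
    (hg : LipschitzWith C g) :
    ∫ y, -(fderiv ℝ g y (w y)) * σ y =
      ∫ y, g y * (flowDeriv w σ y + σ y * divergence w y) := by
  have hwi : ∀ i, ContDiff ℝ 1 (fun y => w y i) := fun i => contDiff_euclidean.1 hw i
  have hprod : ∀ i, ContDiff ℝ 1 (fun y => σ y * w y i) := fun i => hσ.mul (hwi i)
  have hsupp : ∀ i, HasCompactSupport (fun y => σ y * w y i) := fun i => hσs.mul_right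
  have hparts : ∀ i : Fin (n + 1),
      ∫ y, -(lineDeriv ℝ g y (EuclideanSpace.single i 1) * (σ y * w y i)) =
        ∫ y, g y * fderiv ℝ (fun z => σ z * w z i) y (EuclideanSpace.single i 1) := by
    intro i
    obtain ⟨D, hD⟩ := (hprod i).lipschitzWith_of_hasCompactSupport (hsupp i) one_ne_zero
    rw [integral_neg, hg.integral_lineDeriv_mul_eq hD (hsupp i), ← integral_neg]
    refine integral_congr_ae (Filter.Eventually.of_forall fun y => ?_)
    simp only
    rw [(((hprod i).differentiable one_ne_zero) y).lineDeriv_eq_fderiv, map_neg]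
    ring
  have hint₁ : ∀ i : Fin (n + 1),
      Integrable fun y => -(lineDeriv ℝ g y (EuclideanSpace.single i 1) * (σ y * w y i)) := by
    intro i
    refine Integrable.neg ?_
    exact ((hprod i).continuous.integrable_of_hasCompactSupport (hsupp i)).bdd_mul
      (measurable_lineDeriv hg.continuous).aestronglyMeasurable
      (Filter.Eventually.of_forall fun y => norm_lineDeriv_le_of_lipschitz ℝ hg)
  have hint₂ : ∀ i : Fin (n + 1),
      Integrable fun y => g y * fderiv ℝ (fun z => σ z * w z i) y (EuclideanSpace.single i 1) := by
    intro i
    refine Continuous.integrable_of_hasCompactSupport ?_ ?_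
    · exact hg.continuous.mul
        (((hprod i).continuous_fderiv one_ne_zero).clm_apply continuous_const)
    · exact ((hsupp i).fderiv_apply ℝ _).mul_left
  calc ∫ y, -(fderiv ℝ g y (w y)) * σ y
      = ∫ y, ∑ i, -(lineDeriv ℝ g y (EuclideanSpace.single i 1) * (σ y * w y i)) := by
        refine integral_congr_ae ?_
        filter_upwards [hg.ae_differentiableAt (μ := volume)] with y hy
        conv_lhs => rw [eq_sum_smul_single (w y)]
        rw [map_sum, ← Finset.sum_neg_distrib, Finset.sum_mul]
        refine Finset.sum_congr rfl fun i _ => ?_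
        rw [hy.lineDeriv_eq_fderiv, map_smul, smul_eq_mul]
        ring
    _ = ∫ y, ∑ i, g y * fderiv ℝ (fun z => σ z * w z i) y (EuclideanSpace.single i 1) := by
        rw [integral_finsetSum _ fun i _ => hint₁ i, integral_finsetSum _ fun i _ => hint₂ i]
        exact Finset.sum_congr rfl fun i _ => hparts i
    _ = _ := by
        refine integral_congr_ae (Filter.Eventually.of_forall fun y => ?_)
        simp only
        rw [flowDeriv_add_mul_divergence (hσ.differentiable one_ne_zero y)
          (hw.differentiable one_ne_zero y), Finset.mul_sum]

end Divergence

/-! ### The derivative of the integral of a transported function -/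

namespace IsGlobalFlow

variable {n : ℕ} {w : Space n → Space n} {Φ : ℝ → Space n → Space n} {σ g : Space n → ℝ}

theorem hasDerivAt_integral_zero (hΦ : IsGlobalFlow w Φ) (hw : ContDiff ℝ 1 w)
    (hws : HasCompactSupport w) (hσ : ContDiff ℝ 1 σ) (hσs : HasCompactSupport σ) {C : NNReal}
    (hg : LipschitzWith C g) :
    HasDerivAt (fun h => ∫ y, g (Φ (-h) y) * σ y)
      (∫ y, g y * (flowDeriv w σ y + σ y * divergence w y)) 0 := by
  obtain ⟨K, hK⟩ := hw.lipschitzWith_of_hasCompactSupport hws one_ne_zero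
  obtain ⟨M, hM⟩ := hws.exists_bound_of_continuous hw.continuous
  replace hM : ∀ x, ‖w x‖ ≤ M.toNNReal := fun x => (hM x).trans (Real.le_coe_toNNReal M)
  rw [← integral_neg_fderiv_mul_eq hw hσ hσs hg]
  have hcont : ∀ h, Continuous fun y => g (Φ (-h) y) * σ y := fun h =>
    (hg.continuous.comp (hΦ.lipschitzWith hK (-h)).continuous).mul hσ.continuous
  refine (hasDerivAt_integral_of_dominated_loc_of_lip (s := Set.univ)
    (bound := fun y => C * M.toNNReal * |σ y|) Filter.univ_mem
    (Filter.Eventually.of_forall fun h => (hcont h).aestronglyMeasurable)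
    ((hcont 0).integrable_of_hasCompactSupport hσs.mul_left) ?_ ?_ ?_ ?_).2
  · have h1 : Measurable fun y => fderiv ℝ g y (w y) := by
      have : (fun y => fderiv ℝ g y (w y)) =
          fun y => ∑ i, w y i * fderiv ℝ g y (EuclideanSpace.single i 1) := by
        funext y
        conv_lhs => rw [eq_sum_smul_single (w y)]
        simp
      rw [this]
      exact Finset.measurable_fun_sum _ fun i _ =>
        ((contDiff_euclidean.1 hw i).continuous.measurable).mul (measurable_fderiv_apply_const ℝ g _)
    exact (h1.neg.mul hσ.continuous.measurable).aestronglyMeasurable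
  · refine Filter.Eventually.of_forall fun y => LipschitzWith.lipschitzOnWith ?_
    refine LipschitzWith.of_dist_le_mul fun s t => ?_
    have h1 : dist (g (Φ (-s) y)) (g (Φ (-t) y)) ≤ C * (M.toNNReal * dist s t) := by
      refine (hg.dist_le_mul _ _).trans (mul_le_mul_of_nonneg_left ?_ C.2)
      rw [← dist_neg_neg s t]
      exact (hΦ.lipschitzWith_time hM y).dist_le_mul (-s) (-t)
    rw [Real.dist_eq, ← sub_mul, abs_mul, ← Real.dist_eq]
    have h2 : ((Real.nnabs (C * M.toNNReal * |σ y|) : NNReal) : ℝ) = C * M.toNNReal * |σ y| := by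
      rw [Real.coe_nnabs, abs_of_nonneg (by positivity)]
    rw [h2]
    calc _ ≤ C * (M.toNNReal * dist s t) * |σ y| :=
          mul_le_mul_of_nonneg_right h1 (abs_nonneg _)
      _ = _ := by ring
  · exact (hσ.continuous.abs.integrable_of_hasCompactSupport
      (hσs.comp_left abs_zero)).const_mul _
  · filter_upwards [hg.ae_differentiableAt (μ := volume)] with y hy
    have h0 : HasDerivAt (fun h => Φ (-h) y) (-(w y)) 0 := by
      simpa [hΦ.zero] using hΦ.reverse.hasDerivAt y 0
    have hy' : HasFDerivAt g (fderiv ℝ g y) (Φ (-0) y) := by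
      rw [neg_zero, hΦ.zero]
      exact hy.hasFDerivAt
    simpa using (hy'.comp_hasDerivAt (0 : ℝ) h0).mul_const (σ y)

/-- The Liouville formula in weak form. The flow enters only through the transported function
`g ∘ Φ (-s)`, which is Lipschitz by Grönwall's inequality, so that no differentiability of the flow
in the initial point is used. -/
theorem hasDerivAt_integral (hΦ : IsGlobalFlow w Φ) (hw : ContDiff ℝ 1 w)
    (hws : HasCompactSupport w) (hσ : ContDiff ℝ 1 σ) (hσs : HasCompactSupport σ) {C : NNReal}
    (hg : LipschitzWith C g) (s : ℝ) :
    HasDerivAt (fun t => ∫ y, g (Φ (-t) y) * σ y)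
      (∫ y, g (Φ (-s) y) * (flowDeriv w σ y + σ y * divergence w y)) s := by
  obtain ⟨K, hK⟩ := hw.lipschitzWith_of_hasCompactSupport hws one_ne_zero
  have h := hΦ.hasDerivAt_integral_zero hw hws hσ hσs (hg.comp (hΦ.lipschitzWith hK (-s)))
  rw [← sub_self s] at h
  have h' := h.comp_sub_const s s
  refine h'.congr_of_eventuallyEq (Filter.Eventually.of_forall fun t => ?_)
  simp only [Function.comp_apply]
  congr 1 with y
  rw [← hΦ.add hK]
  congr 3
  ring

end IsGlobalFlow

/-! ### The local flow as a restriction of a global one -/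

section LocalFlow

variable {n : ℕ} {v w : Space n → Space n} {U K' : Set (Space n)} {Φ : ℝ → Space n → Space n}

/-- A trajectory of `v` that stays where `w = v` is a trajectory of the global flow of `w`. -/
theorem IsGlobalFlow.eq_of_isIntegralCurveOn_of_eqOn (hΦ : IsGlobalFlow w Φ) {K : NNReal}
    (hw : LipschitzWith K w) {γ : ℝ → Space n} {t : ℝ}
    (hγ : IsIntegralCurveOn γ (fun _ => v) (Set.uIcc 0 t))
    (hwv : ∀ s ∈ Set.uIcc 0 t, w (γ s) = v (γ s)) :
    ∀ s ∈ Set.uIcc 0 t, γ s = Φ s (γ 0) :=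
  hΦ.eq_of_isIntegralCurveOn hw fun s hs => by
    simpa only [hwv s hs] using hγ s hs

/-- A `C¹` vector field on an open set coincides near a compact subset with a complete one. -/
theorem exists_isGlobalFlow_eqOn (hU : IsOpen U) (hv : ContDiffOn ℝ 1 v U) (hK' : IsCompact K')
    (hK'U : K' ⊆ U) :
    ∃ (w : Space n → Space n) (Φ : ℝ → Space n → Space n), ContDiff ℝ 1 w ∧
      HasCompactSupport w ∧ (∀ x ∈ K', w =ᶠ[nhds x] v) ∧ IsGlobalFlow w Φ := by
  obtain ⟨w, hw, hws, hwv⟩ := hv.exists_hasCompactSupport_eqOn hU hK' hK'U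
  obtain ⟨K, hK⟩ := hw.lipschitzWith_of_hasCompactSupport hws one_ne_zero
  obtain ⟨M, hM⟩ := hws.exists_bound_of_continuous hw.continuous
  obtain ⟨Φ, hΦ⟩ := exists_isGlobalFlow hK hM
  exact ⟨w, Φ, hw, hws, hwv, hΦ⟩

/-- Any two trajectories of `v` in `U` are trajectories of one and the same complete field. -/
theorem FlowsTo.exists_isGlobalFlow (hU : IsOpen U) (hv : ContDiffOn ℝ 1 v U) {t : ℝ}
    {x x' y y' : Space n} (h : FlowsTo v U t x y) (h' : FlowsTo v U t x' y') :
    ∃ (w : Space n → Space n) (Φ : ℝ → Space n → Space n) (K : NNReal), LipschitzWith K w ∧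
      IsGlobalFlow w Φ ∧ y = Φ t x ∧ y' = Φ t x' := by
  obtain ⟨γ, rfl, rfl, hγU, hγ⟩ := h
  obtain ⟨γ', rfl, rfl, hγU', hγ'⟩ := h'
  have hcpt : IsCompact (γ '' Set.uIcc 0 t ∪ γ' '' Set.uIcc 0 t) :=
    (isCompact_uIcc.image_of_continuousOn hγ.continuousOn).union
      (isCompact_uIcc.image_of_continuousOn hγ'.continuousOn)
  obtain ⟨w, Φ, hw, hws, hwv, hΦ⟩ := exists_isGlobalFlow_eqOn hU hv hcpt
    (Set.union_subset (Set.image_subset_iff.2 hγU) (Set.image_subset_iff.2 hγU'))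
  obtain ⟨K, hK⟩ := hw.lipschitzWith_of_hasCompactSupport hws one_ne_zero
  exact ⟨w, Φ, K, hK, hΦ,
    hΦ.eq_of_isIntegralCurveOn_of_eqOn hK hγ
      (fun s hs => (hwv _ (Or.inl ⟨s, hs, rfl⟩)).self_of_nhds) t Set.right_mem_uIcc,
    hΦ.eq_of_isIntegralCurveOn_of_eqOn hK hγ'
      (fun s hs => (hwv _ (Or.inr ⟨s, hs, rfl⟩)).self_of_nhds) t Set.right_mem_uIcc⟩

theorem FlowsTo.eq_left (hU : IsOpen U) (hv : ContDiffOn ℝ 1 v U) {t : ℝ} {x x' y : Space n}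
    (h : FlowsTo v U t x y) (h' : FlowsTo v U t x' y) : x = x' := by
  obtain ⟨w, Φ, K, hK, hΦ, h1, h2⟩ := h.exists_isGlobalFlow hU hv h'
  rw [← hΦ.neg_apply hK t x, ← h1, h2, hΦ.neg_apply hK]

theorem FlowsTo.eq_right (hU : IsOpen U) (hv : ContDiffOn ℝ 1 v U) {t : ℝ} {x y y' : Space n}
    (h : FlowsTo v U t x y) (h' : FlowsTo v U t x y') : y = y' := by
  obtain ⟨w, Φ, K, hK, hΦ, h1, h2⟩ := h.exists_isGlobalFlow hU hv h'
  rw [h1, h2]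

theorem IsGlobalFlow.flowsTo (hΦ : IsGlobalFlow w Φ) (hK'U : K' ⊆ U) (hwv : Set.EqOn w v K')
    {t : ℝ} {x : Space n} (hx : ∀ s ∈ Set.uIcc 0 t, Φ s x ∈ K') : FlowsTo v U t x (Φ t x) :=
  ⟨fun s => Φ s x, hΦ.zero x, rfl, fun s hs => hK'U (hx s hs), fun s hs => by
    simpa only [← hwv (hx s hs)] using (hΦ.hasDerivAt x s).hasDerivWithinAt⟩

/-- If the trajectories of the points with `Δ ≠ 0` stay where `w = v`, transport by the local flow
of `v` is composition with the inverse of the global flow of `w`. Off these points the two flows may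
differ, but there both sides vanish, by uniqueness of the trajectories of `v`. -/
theorem IsGlobalFlow.transport_eq (hΦ : IsGlobalFlow w Φ) (hU : IsOpen U)
    (hv : ContDiffOn ℝ 1 v U) {K : NNReal} (hw : LipschitzWith K w) (hK'U : K' ⊆ U)
    (hwv : Set.EqOn w v K') {Δ : Space n → ℝ} {t : ℝ}
    (hΔ : ∀ x, Δ x ≠ 0 → ∀ s ∈ Set.uIcc 0 t, Φ s x ∈ K') :
    transport v U t Δ = fun y => Δ (Φ (-t) y) := by
  funext y
  rw [transport]
  have hback : Δ (Φ (-t) y) ≠ 0 → FlowsTo v U t (Φ (-t) y) y := fun h => by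
    simpa only [hΦ.apply_neg hw] using hΦ.flowsTo hK'U hwv (hΔ _ h)
  split_ifs with h
  · have hx := h.choose_spec
    set x := h.choose
    by_cases h0 : Δ x = 0
    · by_contra hne
      have hne' : Δ (Φ (-t) y) ≠ 0 := fun h1 => hne (h0.trans h1.symm)
      exact hne' (by rw [← hx.eq_left hU hv (hback hne'), h0])
    · rw [hx.eq_right hU hv (hΦ.flowsTo hK'U hwv (hΔ x h0)), hΦ.neg_apply hw]
  · by_contra hne
    exact h ⟨_, hback (Ne.symm hne)⟩

/-- The transported function vanishes off `K'`, so that only the values of the density on `K' ⊆ U`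
matter. -/
theorem IsGlobalFlow.setIntegral_comp_neg_mul (hΦ : IsGlobalFlow w Φ) {K : NNReal} (hw : LipschitzWith K w) (hK'U : K' ⊆ U) {Δ ρ σ : Space n → ℝ} (hσρ : Set.EqOn σ ρ K') {t : ℝ}
    (hΔ : ∀ x, Δ x ≠ 0 → Φ t x ∈ K') :
    ∫ y in U, Δ (Φ (-t) y) * ρ y = ∫ y, Δ (Φ (-t) y) * σ y := by
  have hmem : ∀ y, Δ (Φ (-t) y) ≠ 0 → y ∈ K' := fun y hy => by
    simpa only [hΦ.apply_neg hw] using hΔ _ hy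
  rw [setIntegral_eq_integral_of_forall_compl_eq_zero fun y hy => by
    by_contra hne
    exact hy (hK'U (hmem y (left_ne_zero_of_mul hne)))]
  refine integral_congr_ae (Filter.Eventually.of_forall fun y => ?_)
  by_cases hy : Δ (Φ (-t) y) = 0
  · simp only [hy, zero_mul]
  · simp only [hσρ (hmem y hy)]

/-- The trajectories, up to time `t`, of the points of a compact subset of the domain of `φ_t`
stay in a compact subset of `U`. -/
theorem exists_isCompact_trajectories_subset (hU : IsOpen U) (hv : ContDiffOn ℝ 1 v U) {t : ℝ}
    {S : Set (Space n)} (hS : IsCompact S) (hSt : S ⊆ flowDomain v U t) :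
    ∃ K', IsCompact K' ∧ K' ⊆ U ∧ ∀ x ∈ S, ∃ γ : ℝ → Space n, γ 0 = x ∧
      (∀ s ∈ Set.uIcc 0 t, γ s ∈ K') ∧ IsIntegralCurveOn γ (fun _ => v) (Set.uIcc 0 t) := by
  refine hS.induction_on (p := fun S => ∃ K', IsCompact K' ∧ K' ⊆ U ∧ ∀ x ∈ S,
    ∃ γ : ℝ → Space n, γ 0 = x ∧ (∀ s ∈ Set.uIcc 0 t, γ s ∈ K') ∧
      IsIntegralCurveOn γ (fun _ => v) (Set.uIcc 0 t))
    ⟨∅, isCompact_empty, Set.empty_subset _, by simp⟩ ?_ ?_ ?_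
  · rintro A B hAB ⟨K', h1, h2, h3⟩
    exact ⟨K', h1, h2, fun x hx => h3 x (hAB hx)⟩
  · rintro A B ⟨K₁, h1, h2, h3⟩ ⟨K₂, h1', h2', h3'⟩
    refine ⟨K₁ ∪ K₂, h1.union h1', Set.union_subset h2 h2', ?_⟩
    rintro x (hx | hx)
    · obtain ⟨γ, h0, hm, hc⟩ := h3 x hx
      exact ⟨γ, h0, fun s hs => Or.inl (hm s hs), hc⟩
    · obtain ⟨γ, h0, hm, hc⟩ := h3' x hx
      exact ⟨γ, h0, fun s hs => Or.inr (hm s hs), hc⟩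
  · intro x hx
    obtain ⟨_, γ, rfl, -, hγU, hγ⟩ := hSt hx
    have hcpt : IsCompact (γ '' Set.uIcc 0 t) :=
      isCompact_uIcc.image_of_continuousOn hγ.continuousOn
    obtain ⟨δ, hδ, hδU⟩ := hcpt.exists_cthickening_subset_open hU (Set.image_subset_iff.2 hγU)
    obtain ⟨w, Φ, hw, hws, hwv, hΦ⟩ := exists_isGlobalFlow_eqOn hU hv hcpt.cthickening hδU
    obtain ⟨K, hK⟩ := hw.lipschitzWith_of_hasCompactSupport hws one_ne_zero
    have hγΦ := hΦ.eq_of_isIntegralCurveOn_of_eqOn hK hγ fun s hs =>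
      (hwv _ (Metric.self_subset_cthickening _ ⟨s, hs, rfl⟩)).self_of_nhds
    -- by Grönwall, a point this close to `γ 0` has its trajectory in the `δ`-tube around `γ`
    refine ⟨Metric.ball (γ 0) (δ * Real.exp (-(K * |t|))),
      mem_nhdsWithin_of_mem_nhds (Metric.ball_mem_nhds _ (by positivity)),
      Metric.cthickening δ (γ '' Set.uIcc 0 t), hcpt.cthickening, hδU, fun x hx => ?_⟩
    have hmem : ∀ s ∈ Set.uIcc 0 t, Φ s x ∈ Metric.cthickening δ (γ '' Set.uIcc 0 t) := by
      intro s hs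
      refine Metric.mem_cthickening_of_dist_le _ (γ s) δ _ ⟨s, hs, rfl⟩ ?_
      have hst : |s| ≤ |t| := by
        simpa using Set.abs_sub_left_of_mem_uIcc hs
      rw [hγΦ s hs]
      calc dist (Φ s x) (Φ s (γ 0)) ≤ dist x (γ 0) * Real.exp (K * |s|) := hΦ.dist_le hK s x _
        _ ≤ δ * Real.exp (-(K * |t|)) * Real.exp (K * |t|) := by
            gcongr
            exact (Metric.mem_ball.1 hx).le
        _ = δ := by
            rw [mul_assoc, ← Real.exp_add, neg_add_cancel, Real.exp_zero, mul_one]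
    exact ⟨fun s => Φ s x, hΦ.zero x, hmem, fun s hs => by
      simpa only [← (hwv _ (hmem s hs)).self_of_nhds] using
        (hΦ.hasDerivAt x s).hasDerivWithinAt⟩

end LocalFlow

/-! ### Preserved measures and integrals of the flow -/

section Preserved

variable {n : ℕ} {v : Space n → Space n} {U : Set (Space n)}

theorem eq_of_hasDerivWithinAt_zero_uIcc {f : ℝ → ℝ} {t : ℝ}
    (hf : ∀ s ∈ Set.uIcc 0 t, HasDerivWithinAt f 0 (Set.uIcc 0 t) s) : f t = f 0 := by
  have h := (convex_uIcc 0 t).norm_image_sub_le_of_norm_hasDerivWithin_le (C := 0) hf (by simp)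
    Set.left_mem_uIcc Set.right_mem_uIcc
  rw [zero_mul, norm_le_zero_iff] at h
  exact sub_eq_zero.1 h

theorem SolvesDensityEq.preservedByFlow (hU : IsOpen U) (hv : ContDiffOn ℝ 1 v U)
    {ρ : Space n → ℝ} (hρ : ContDiffOn ℝ 1 ρ U) (h : SolvesDensityEq v U ρ) :
    PreservedByFlow v U ρ := by
  intro Δ hΔ hΔs hΔU t ht
  obtain ⟨K', hK', hK'U, htraj⟩ := exists_isCompact_trajectories_subset hU hv hΔs.isCompact ht
  obtain ⟨w, Φ, hw, hws, hwv, hΦ⟩ := exists_isGlobalFlow_eqOn hU hv hK' hK'U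
  obtain ⟨σ, hσ, hσs, hσρ⟩ := hρ.exists_hasCompactSupport_eqOn hU hK' hK'U
  obtain ⟨K, hK⟩ := hw.lipschitzWith_of_hasCompactSupport hws one_ne_zero
  obtain ⟨C, hC⟩ := hΔ.lipschitzWith_of_hasCompactSupport hΔs (by simp)
  have hmem : ∀ x, Δ x ≠ 0 → ∀ s ∈ Set.uIcc 0 t, Φ s x ∈ K' := by
    intro x hx s hs
    obtain ⟨γ, rfl, hγK', hγ⟩ := htraj x (subset_tsupport _ hx)
    rw [← hΦ.eq_of_isIntegralCurveOn_of_eqOn hK hγ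
      (fun r hr => (hwv _ (hγK' r hr)).self_of_nhds) s hs]
    exact hγK' s hs
  have hσρ' : Set.EqOn σ ρ K' := fun x hx => (hσρ x hx).self_of_nhds
  have hconst := eq_of_hasDerivWithinAt_zero_uIcc (t := t)
    (f := fun s => ∫ y, Δ (Φ (-s) y) * σ y) fun s hs => by
      have hd := (hΦ.hasDerivAt_integral hw hws hσ hσs hC s).hasDerivWithinAt
        (s := Set.uIcc 0 t)
      rwa [integral_eq_zero_of_ae (Filter.Eventually.of_forall fun y => ?_)] at hd
      by_cases hy : Δ (Φ (-s) y) = 0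
      · simp only [hy, zero_mul, Pi.zero_apply]
      · have hyK' : y ∈ K' := by simpa only [hΦ.apply_neg hK] using hmem _ hy s hs
        simp only [flowDeriv_add_mul_divergence_congr (hwv y hyK') (hσρ y hyK'),
          h y (hK'U hyK'), mul_zero, Pi.zero_apply]
  rw [hΦ.transport_eq hU hv hK hK'U (fun x hx => (hwv x hx).self_of_nhds) hmem,
    hΦ.setIntegral_comp_neg_mul hK hK'U hσρ' (fun x hx => hmem x hx t Set.right_mem_uIcc),
    hconst,
    ← hΦ.setIntegral_comp_neg_mul hK hK'U hσρ' (fun x hx => hmem x hx 0 Set.left_mem_uIcc)]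
  simp only [neg_zero, hΦ.zero]

/-- Testing preservation for small times only gives the vanishing at time `0` of the derivative of
`t ↦ μ(Δ_t)`, which is the integral of `Δ` against the left-hand side of the density equation. -/
theorem PreservedByFlow.integral_mul_eq_zero (hU : IsOpen U) (hv : ContDiffOn ℝ 1 v U)
    {ρ : Space n → ℝ} (hρ : ContDiffOn ℝ 1 ρ U) (h : PreservedByFlow v U ρ) {Δ : Space n → ℝ}
    (hΔ : ContDiff ℝ ∞ Δ) (hΔs : HasCompactSupport Δ) (hΔU : tsupport Δ ⊆ U) :
    ∫ y, Δ y * (flowDeriv v ρ y + ρ y * divergence v y) = 0 := by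
  obtain ⟨δ, hδ, hδU⟩ := hΔs.isCompact.exists_cthickening_subset_open hU hΔU
  set K' := Metric.cthickening δ (tsupport Δ)
  have hK' : IsCompact K' := hΔs.isCompact.cthickening
  obtain ⟨w, Φ, hw, hws, hwv, hΦ⟩ := exists_isGlobalFlow_eqOn hU hv hK' hδU
  obtain ⟨σ, hσ, hσs, hσρ⟩ := hρ.exists_hasCompactSupport_eqOn hU hK' hδU
  obtain ⟨K, hK⟩ := hw.lipschitzWith_of_hasCompactSupport hws one_ne_zero
  obtain ⟨C, hC⟩ := hΔ.lipschitzWith_of_hasCompactSupport hΔs (by simp)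
  obtain ⟨M, hM⟩ := hws.exists_bound_of_continuous hw.continuous
  replace hM : ∀ x, ‖w x‖ ≤ M.toNNReal := fun x => (hM x).trans (Real.le_coe_toNNReal M)
  have hσρ' : Set.EqOn σ ρ K' := fun x hx => (hσρ x hx).self_of_nhds
  have hwv' : Set.EqOn w v K' := fun x hx => (hwv x hx).self_of_nhds
  -- points of the support move at speed at most `M`, so that they stay in `K'` for short times
  have hmem : ∀ t : ℝ, M.toNNReal * |t| < δ → ∀ x ∈ tsupport Δ, ∀ s ∈ Set.uIcc 0 t,
      Φ s x ∈ K' := by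
    intro t ht x hx s hs
    refine Metric.mem_cthickening_of_dist_le _ x δ _ hx ?_
    have hst : |s| ≤ |t| := by simpa using Set.abs_sub_left_of_mem_uIcc hs
    have hd := (hΦ.lipschitzWith_time hM x).dist_le_mul s 0
    simp only [hΦ.zero, dist_zero_right, Real.norm_eq_abs] at hd
    exact (hd.trans (mul_le_mul_of_nonneg_left hst M.toNNReal.2)).trans ht.le
  have hsmall : ∀ᶠ t : ℝ in nhds 0, M.toNNReal * |t| < δ :=
    (continuous_const.mul continuous_abs).continuousAt.eventually_lt continuousAt_const
      (by simpa using hδ)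
  have hconst : (fun t => ∫ y, Δ (Φ (-t) y) * σ y) =ᶠ[nhds 0]
      fun _ => ∫ y in U, Δ y * ρ y := by
    filter_upwards [hsmall] with t ht
    have hΔt : ∀ x, Δ x ≠ 0 → ∀ s ∈ Set.uIcc 0 t, Φ s x ∈ K' := fun x hx =>
      hmem t ht x (subset_tsupport _ hx)
    rw [← hΦ.setIntegral_comp_neg_mul hK hδU hσρ' (fun x hx => hΔt x hx t Set.right_mem_uIcc),
      ← h Δ hΔ hΔs hΔU t fun x hx => ⟨_, hΦ.flowsTo hδU hwv' (hmem t ht x hx)⟩,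
      hΦ.transport_eq hU hv hK hδU hwv' hΔt]
  have hderiv := (hΦ.hasDerivAt_integral_zero hw hws hσ hσs hC).unique
    ((hasDerivAt_const (0 : ℝ) _).congr_of_eventuallyEq hconst)
  rw [← hderiv]
  refine integral_congr_ae (Filter.Eventually.of_forall fun y => ?_)
  by_cases hy : Δ y = 0
  · simp only [hy, zero_mul]
  · have hyK' : y ∈ K' := Metric.self_subset_cthickening _ (subset_tsupport _ hy)
    simp only [flowDeriv_add_mul_divergence_congr (hwv y hyK') (hσρ y hyK')]

theorem PreservedByFlow.solvesDensityEq (hU : IsOpen U) (hv : ContDiffOn ℝ 1 v U)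
    {ρ : Space n → ℝ} (hρ : ContDiffOn ℝ 1 ρ U) (h : PreservedByFlow v U ρ) :
    SolvesDensityEq v U ρ := by
  have hcont := continuousOn_flowDeriv_add_mul_divergence hU hv hρ
  have hae := hU.ae_eq_zero_of_integral_contDiff_smul_eq_zero (μ := volume)
    (hcont.locallyIntegrableOn hU.measurableSet)
    fun Δ hΔ hΔs hΔU => h.integral_mul_eq_zero hU hv hρ hΔ hΔs hΔU
  exact Measure.eqOn_open_of_ae_eq ((ae_restrict_iff' hU.measurableSet).2 hae) hU hcont
    continuousOn_const

theorem SolvesDensityEq.isLocalIntegral_div (hU : IsOpen U) {ρA ρB : Space n → ℝ}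
    (hρA : ContDiffOn ℝ 1 ρA U) (hρB : ContDiffOn ℝ 1 ρB U) (hA : SolvesDensityEq v U ρA)
    (hB : SolvesDensityEq v U ρB) {W : Set (Space n)} (hW : IsOpen W) (hWU : W ⊆ U)
    (hne : ∀ x ∈ W, ρB x ≠ 0)
    (hli : LinearIndependent ℝ ![W.domRestrict ρA, W.domRestrict ρB]) :
    IsLocalIntegral v W (fun x => ρA x / ρB x) := by
  have hC1 : ContDiffOn ℝ 1 (fun x => ρA x / ρB x) W :=
    (hρA.mono hWU).div (hρB.mono hWU) hne
  have hzero : ∀ x ∈ W, flowDeriv v (fun x => ρA x / ρB x) x = 0 := by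
    intro x hx
    have hdB : DifferentiableAt ℝ ρB x :=
      (hρB.contDiffAt (hU.mem_nhds (hWU hx))).differentiableAt one_ne_zero
    have hdq : DifferentiableAt ℝ (fun x => ρA x / ρB x) x :=
      (hC1.contDiffAt (hW.mem_nhds hx)).differentiableAt one_ne_zero
    have hmul : ρA =ᶠ[nhds x] fun x => ρA x / ρB x * ρB x := by
      filter_upwards [hW.mem_nhds hx] with y hy using (div_mul_cancel₀ _ (hne y hy)).symm
    have eA := hA x (hWU hx)
    have eB := hB x (hWU hx)
    rw [flowDeriv_eq_fderiv] at eA eB ⊢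
    rw [hmul.fderiv_eq, fderiv_fun_mul hdq hdB] at eA
    simp only [smul_apply, add_apply, smul_eq_mul] at eA
    refine (mul_eq_zero.1 ?_).resolve_left (hne x hx)
    linear_combination eA - ρA x / ρB x * eB - divergence v x * hmul.self_of_nhds
  refine ⟨hC1, hzero, ?_, ?_⟩
  · rintro t x y ⟨γ, rfl, rfl, hγW, hγ⟩
    refine eq_of_hasDerivWithinAt_zero_uIcc (f := fun s => ρA (γ s) / ρB (γ s)) fun s hs => ?_
    have hd : DifferentiableAt ℝ (fun x => ρA x / ρB x) (γ s) :=
      (hC1.contDiffAt (hW.mem_nhds (hγW s hs))).differentiableAt one_ne_zero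
    have hcomp := hd.hasFDerivAt.comp_hasDerivWithinAt s (hγ s hs)
    rwa [← flowDeriv_eq_fderiv, hzero _ (hγW s hs)] at hcomp
  · by_contra! hconst
    rcases W.eq_empty_or_nonempty with rfl | ⟨x₀, hx₀⟩
    · exact hli.ne_zero 0 (Subsingleton.elim _ _)
    · rw [LinearIndependent.pair_iff] at hli
      refine one_ne_zero (hli 1 (-(ρA x₀ / ρB x₀)) ?_).1
      ext ⟨x, hx⟩
      have hρx : ρB x ≠ 0 := hne x hx
      simp only [one_smul, Pi.add_apply, Pi.smul_apply, Set.domRestrict_apply, smul_eq_mul,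
        Pi.zero_apply, hconst x₀ hx₀ x hx]
      field_simp
      ring

end Preserved

theorem mainTheorem3 (n : ℕ) (U : Set (Space n)) (hU : IsOpen U) (v : Space n → Space n)
    (hv : ContDiffOn ℝ 1 v U) :
    (∀ ρ : Space n → ℝ, ContDiffOn ℝ 1 ρ U →
      (PreservedByFlow v U ρ ↔ SolvesDensityEq v U ρ)) ∧
    (∀ ρA ρB : Space n → ℝ, ContDiffOn ℝ 1 ρA U → ContDiffOn ℝ 1 ρB U →
      SolvesDensityEq v U ρA → SolvesDensityEq v U ρB →
      ∀ W : Set (Space n), IsOpen W → W ⊆ U → (∀ x ∈ W, ρB x ≠ 0) →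
        LinearIndependent ℝ ![W.domRestrict ρA, W.domRestrict ρB] →
        IsLocalIntegral v W (fun x => ρA x / ρB x)) :=
  ⟨fun _ hρ => ⟨fun h => h.solvesDensityEq hU hv hρ, fun h => h.preservedByFlow hU hv hρ⟩,
    fun _ _ hρA hρB hA hB _ hW hWU hne hli =>
      hA.isLocalIntegral_div hU hρA hρB hB hW hWU hne hli⟩
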